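/- Let $0<q<1$, let $k,m,N\in\mathbb{N}_0$, $n\in\{0,1,\dots,N\}$, and let $\alpha,\beta\in\mathbb{R}$ satisfy $0<\alpha q<1$ and $0<\beta q<1$. Write $(a;q)_j=\prod_{i=0}^{j-1}(1-aq^i)$. For real $a,b$ let $$\tilde Q_n(\bar x;a,b,N|q)=\frac{(aq;q)_n(q^{-N};q)_n}{(abq^{n+1};q)_n}\sum_{j=0}^{n}\frac{(q^{-n};q)_j\,(abq^{n+1};q)_j\,(\bar x;q)_j}{(aq;q)_j\,(q^{-N};q)_j}\,\frac{q^j}{(q;q)_j}$$ be the monic $q$-Hahn polynomial in the variable $\bar x=q^{-x}$, and let $$w(i)=\frac{(\alpha q;q)_i\,(q^{-N};q)_i}{(q;q)_i\,(\beta^{-1}q^{-N};q)_i\,(\alpha\beta q)^i},\qquad i=0,1,\dots,N.$$ A real polynomial $Q$ is called discrete quasi-orthogonal of order $r\le n$ on $(1,q^{-N})$ with respect to $w$ if it has exact degree $n$, all weights $w(0),\dots,w(N)$ at the distinct points $q^{-i}\in[1,q^{-N}]$, $0\le i\le N$, are positive, and $$\sum_{i=0}^{N}(q^{-i})^{s}\,Q(q^{-i})\,w(i)\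 \begin{cases}=0,& s\in\{0,1,\dots,n-r-1\},\\ \neq 0,& s=n-r.\end{cases}$$ Then: (i) if $\alpha>1$ and $k\le n-1$, then $\tilde Q_n(\bar x;\alpha/q^k,\beta,N|q)$ is discrete quasi-orthogonal of order $k$ on $(1,q^{-N})$ with respect to $w$, and has at least $n-k$ real, distinct zeros in $(1,q^{-N})$; (ii) if $\beta>1$ and $m\le n-1$, then $\tilde Q_n(\bar x;\alpha,\beta/q^m,N|q)$ is discrete quasi-orthogonal of order $m$ on $(1,q^{-N})$ with respect to $w$, and has at least $n-m$ real, distinct zeros in $(1,q^{-N})$; (iii) if $\alpha,\beta>1$ and $k+m\le n-1$, then $\tilde Q_n(\bar x;\alpha/q^k,\beta/q^m,N|q)$ is discrete quasi-orthogonal of order $k+m$ on $(1,q^{-N})$ with respect to $w$, and has at least $n-(k+m)$ real, distinct zeros in $(1,q^{-N})$. -/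

import Mathlib

open Polynomial Finset

noncomputable section

namespace QHahn

/-- The `q`-Pochhammer symbol `(a; q)_m = ∏_{j=0}^{m-1} (1 - a q^j)`. -/
def qPoch (a q : ℝ) (m : ℕ) : ℝ := ∏ j ∈ range m, (1 - a * q ^ j)

/-- The `q`-Pochhammer symbol `(X; q)_m` of the indeterminate, as a real polynomial. -/
def qPochX (q : ℝ) (m : ℕ) : ℝ[X] := ∏ j ∈ range m, (1 - X * C (q ^ j))

/-- The basic hypergeometric series `_rφ_s(a_1, …, a_r; b_1, …, b_s; q; z)`. -/
def qHyp (as bs : List ℝ) (q z : ℝ) : ℝ :=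
  ∑' m : ℕ, (as.map fun a => qPoch a q m).prod / (bs.map fun b => qPoch b q m).prod *
    ((-1) ^ m * q ^ m.choose 2) ^ (1 + (bs.length : ℤ) - (as.length : ℤ)) *
    (z ^ m / qPoch q q m)

/-- The monic `q`-Hahn polynomial `Q̃_n(x̄; α, β, N | q)` as a polynomial in `x̄ = q^{-x}`:
`(αq;q)_n (q^{-N};q)_n / (αβq^{n+1};q)_n` times
`_3φ_2(q^{-n}, αβq^{n+1}, x̄; αq, q^{-N}; q; q)`.
The series stops at the index `n` because `(q^{-n};q)_j = 0` for `j > n`. -/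
def qHahn (q α β : ℝ) (N n : ℕ) : ℝ[X] :=
  C (qPoch (α * q) q n * qPoch (q ^ (-(N : ℤ))) q n / qPoch (α * β * q ^ (n + 1)) q n) *
    ∑ j ∈ range (n + 1),
      C (qPoch (q ^ (-(n : ℤ))) q j * qPoch (α * β * q ^ (n + 1)) q j /
          (qPoch (α * q) q j * qPoch (q ^ (-(N : ℤ))) q j) * (q ^ j / qPoch q q j)) *
        qPochX q j

/-- The discrete `q`-Hahn weight
`w(x) = (αq, q^{-N}; q)_x / ((q, β^{-1}q^{-N}; q)_x (αβq)^x)`, for `x = 0, 1, …, N`. -/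
def weight (q α β : ℝ) (N x : ℕ) : ℝ :=
  qPoch (α * q) q x * qPoch (q ^ (-(N : ℤ))) q x /
    (qPoch q q x * qPoch (β⁻¹ * q ^ (-(N : ℤ))) q x * (α * β * q) ^ x)

/-- The polynomial `Q` of exact degree `n` is discrete quasi-orthogonal of order `k` with respect
to the positive weights `w i` at the `M` distinct points `x i`, `0 ≤ i < M`, of the interval with
end points `a` and `b` (which may themselves be mass points). -/
structure IsDiscreteQuasiOrthogonal (Q : ℝ[X]) (n k M : ℕ) (x w : ℕ → ℝ) (a b : ℝ) : Prop where
  degree_eq : Q.degree = n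
  order_le : k ≤ n
  points_mem : ∀ i < M, x i ∈ Set.Icc a b
  points_inj : Set.InjOn x {i | i < M}
  weight_pos : ∀ i < M, 0 < w i
  sum_eq_zero : ∀ m < n - k, ∑ i ∈ range M, x i ^ m * Q.eval (x i) * w i = 0
  sum_ne_zero : ∑ i ∈ range M, x i ^ (n - k) * Q.eval (x i) * w i ≠ 0

/-- The quasi-orthogonality statement for `q`-Hahn polynomials: `Q`, of degree `n`, is
discrete quasi-orthogonal of order `k` on `(1, q^{-N})` for the `q`-Hahn weight with parameters
`α, β`, which has the `N + 1` mass points `q^{-i}`, `0 ≤ i ≤ N`. -/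
def QuasiOrthogonal (q α β : ℝ) (N : ℕ) (Q : ℝ[X]) (n k : ℕ) : Prop :=
  IsDiscreteQuasiOrthogonal Q n k (N + 1) (fun i => q ^ (-(i : ℤ))) (weight q α β N)
    1 (q ^ (-(N : ℤ)))

/-- The set of zeros of `Q` in the open interval `(1, q^{-N})`. -/
def zerosIn (q : ℝ) (N : ℕ) (Q : ℝ[X]) : Set ℝ :=
  {y | y ∈ Set.Ioo 1 (q ^ (-(N : ℤ))) ∧ Q.IsRoot y}

/-- The polynomial `qHahn` is given by the terminating basic hypergeometric series. -/
theorem eval_qHahn {q : ℝ} (hq : q ≠ 0) (α β : ℝ) (N n : ℕ) (y : ℝ) :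
    (qHahn q α β N n).eval y =
      qPoch (α * q) q n * qPoch (q ^ (-(N : ℤ))) q n / qPoch (α * β * q * q ^ n) q n *
        qHyp [q ^ (-(n : ℤ)), α * β * q ^ (n + 1), y] [α * q, q ^ (-(N : ℤ))] q q := by
  have hX : ∀ j, (qPochX q j).eval y = qPoch y q j := by
    intro j
    simp [qPochX, qPoch, eval_prod]
  have h0 : ∀ j, j ∉ range (n + 1) → qPoch (q ^ (-(n : ℤ))) q j = 0 := by
    intro j hj
    refine prod_eq_zero (i := n) (by simp at hj ⊢; omega) ?_
    rw [zpow_neg, zpow_natCast, inv_mul_cancel₀ (pow_ne_zero n hq), sub_self]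
  have hp : α * β * q * q ^ n = α * β * q ^ (n + 1) := by ring
  unfold qHyp
  rw [tsum_eq_sum (s := range (n + 1)) (by
    intro j hj
    simp only [List.map_cons, List.prod_cons, h0 j hj, zero_mul, zero_div])]
  rw [hp]
  simp only [qHahn, eval_mul, eval_C, eval_finsetSum, hX]
  congr 1
  refine sum_congr rfl fun j _ => ?_
  simp
  ring

end QHahn

end

namespace QHahn

/-! Put `a = α/q^k` and `b = β/q^m`. The polynomial `qHahn q a b N n` remains orthogonal, for its
own possibly sign-changing weight `polyWeight q a b N`, to everything of degree below `n`. Raising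
`a` to `a q^k` and `b` to `b q^m` multiplies that weight, up to a constant, by a polynomial of
degree `k` and one of degree `m` (`polyWeight_mul_prod`, `polyWeight_mul_qPoch`). So the sums
against the positive weight for `α, β` are the old functional applied to polynomials of degree `s +
k + m`: zero below `n`, nonzero at `n`. Orthogonality is tested on `(b q^(N+1) y; q)_s`, which the
weight absorbs as `b ↦ b q^s`. Two `q`-Vandermonde sums then give a product (`hahnFunctional_qHahn`)
that vanishes exactly for `s < n`. The zeros follow from the classical sign argument, valid for a
discrete measure with more than `n` mass points (`IsDiscreteQuasiOrthogonal.le_ncard`). -/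

/-! ### Shifted factorials and Gaussian binomials -/

theorem qPoch_zero (a q : ℝ) : qPoch a q 0 = 1 := by simp [qPoch]

theorem qPoch_succ (a q : ℝ) (m : ℕ) : qPoch a q (m + 1) = qPoch a q m * (1 - a * q ^ m) := by
  simp [qPoch, prod_range_succ]

theorem qPoch_add (a q : ℝ) (m l : ℕ) :
    qPoch a q (m + l) = qPoch a q m * qPoch (a * q ^ m) q l := by
  simp only [qPoch, prod_range_add]
  congr 1
  exact prod_congr rfl fun i _ => by ring

theorem qPoch_succ' (a q : ℝ) (m : ℕ) :
    qPoch a q (m + 1) = (1 - a) * qPoch (a * q) q m := by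
  rw [add_comm, qPoch_add, qPoch_succ, qPoch_zero]
  simp

theorem qPoch_ne_zero {a q : ℝ} {m : ℕ} (h : ∀ j < m, a * q ^ j ≠ 1) : qPoch a q m ≠ 0 :=
  prod_ne_zero_iff.2 fun j hj => sub_ne_zero.2 (h j (mem_range.1 hj)).symm

theorem qPoch_pos_of_lt_one {a q : ℝ} (hq0 : 0 < q) (hq1 : q < 1) (ha0 : 0 < a) (ha : a < 1)
    (m : ℕ) : 0 < qPoch a q m :=
  prod_pos fun _ _ => sub_pos.2 (mul_lt_one_of_nonneg_of_lt_one_left ha0.le ha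
    (pow_le_one₀ hq0.le hq1.le))

/-- The Gaussian binomial coefficient. -/
def qBinom (q : ℝ) : ℕ → ℕ → ℝ
  | _, 0 => 1
  | 0, _ + 1 => 0
  | n + 1, k + 1 => q ^ (k + 1) * qBinom q n (k + 1) + qBinom q n k

theorem qBinom_zero_right (q : ℝ) (n : ℕ) : qBinom q n 0 = 1 := by
  cases n <;> rfl

theorem qBinom_succ_succ (q : ℝ) (n k : ℕ) :
    qBinom q (n + 1) (k + 1) = q ^ (k + 1) * qBinom q n (k + 1) + qBinom q n k := rfl

theorem qBinom_eq_zero_of_lt (q : ℝ) {n k : ℕ} (h : n < k) : qBinom q n k = 0 := by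
  induction n generalizing k with
  | zero =>
    cases k with
    | zero => omega
    | succ k => rfl
  | succ n ih =>
    cases k with
    | zero => omega
    | succ k =>
      rw [qBinom_succ_succ, ih (by omega), ih (by omega)]
      simp

theorem qBinom_self (q : ℝ) (n : ℕ) : qBinom q n n = 1 := by
  induction n with
  | zero => rfl
  | succ n ih => rw [qBinom_succ_succ, qBinom_eq_zero_of_lt q (Nat.lt_succ_self n), ih]; simp

theorem qBinom_add_mul (q : ℝ) (i j : ℕ) :
    qBinom q (i + j) i * (qPoch q q i * qPoch q q j) = qPoch q q (i + j) := by
  induction i generalizing j with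
  | zero => simp [qBinom_zero_right, qPoch_zero]
  | succ i ih =>
    induction j with
    | zero => simp [qBinom_self, qPoch_zero]
    | succ j ihj =>
      have e : i + 1 + (j + 1) = (i + 1 + j) + 1 := by ring
      have e' : i + (j + 1) = i + 1 + j := by ring
      have h := ih (j + 1)
      rw [e'] at h
      rw [e, qBinom_succ_succ, qPoch_succ q q (i + 1 + j)]
      have h1 := qPoch_succ q q i
      have h2 := qPoch_succ q q j
      rw [h2] at h ⊢
      have h3 : qPoch q q (i + 1 + j) * (1 - q * q ^ (i + 1 + j)) =
          q ^ (i + 1) * (1 - q * q ^ j) * qPoch q q (i + 1 + j) +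
            (1 - q * q ^ i) * qPoch q q (i + 1 + j) := by ring
      rw [h3]
      nth_rewrite 1 [← ihj]
      rw [← h, h1]
      ring

/-- Summation against Gaussian binomials, by the first Pascal rule. -/
theorem sum_qBinom_succ (q : ℝ) (n : ℕ) (f : ℕ → ℝ) :
    ∑ x ∈ range (n + 2), qBinom q (n + 1) x * f x =
      ∑ x ∈ range (n + 1), qBinom q n x * (q ^ x * f x + f (x + 1)) := by
  have h : ∑ x ∈ range (n + 1), qBinom q n x * (q ^ x * f x) =
      ∑ x ∈ range (n + 1), qBinom q n (x + 1) * (q ^ (x + 1) * f (x + 1)) + f 0 := by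
    have := sum_range_succ' (fun x => qBinom q n x * (q ^ x * f x)) (n + 1)
    rw [sum_range_succ, qBinom_eq_zero_of_lt q (Nat.lt_succ_self n)] at this
    simpa [qBinom_zero_right] using this
  simp only [mul_add, sum_add_distrib]
  rw [h, sum_range_succ', qBinom_zero_right, one_mul, add_right_comm, ← sum_add_distrib]
  congr 1
  exact sum_congr rfl fun x _ => by rw [qBinom_succ_succ]; ring

theorem qPoch_self_ne_zero {q : ℝ} (hq0 : 0 < q) (hq1 : q < 1) (m : ℕ) : qPoch q q m ≠ 0 :=
  (qPoch_pos_of_lt_one hq0 hq1 hq0 hq1 m).ne'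

theorem qBinom_pos {q : ℝ} (hq0 : 0 < q) (hq1 : q < 1) {n k : ℕ} (hk : k ≤ n) :
    0 < qBinom q n k := by
  obtain ⟨j, rfl⟩ := Nat.exists_eq_add_of_le hk
  have h := qBinom_add_mul q k j
  have hp := qPoch_pos_of_lt_one hq0 hq1 hq0 hq1
  exact pos_of_mul_pos_left (h ▸ hp (k + j)) (mul_pos (hp k) (hp j)).le

/-- This ratio of neighbours converts the defining Pascal rule into the second one. -/
theorem qBinom_succ_right {q : ℝ} (hq0 : 0 < q) (hq1 : q < 1) {n k : ℕ} (hk : k ≤ n) :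
    (1 - q ^ (k + 1)) * qBinom q n (k + 1) = (1 - q ^ (n - k)) * qBinom q n k := by
  obtain rfl | hlt := hk.eq_or_lt
  · simp [qBinom_eq_zero_of_lt q (Nat.lt_succ_self k)]
  obtain ⟨j, rfl⟩ := Nat.exists_eq_add_of_lt hlt
  have h1 := qBinom_add_mul q (k + 1) j
  have h2 := qBinom_add_mul q k (j + 1)
  have hk := qPoch_self_ne_zero hq0 hq1 k
  have hj := qPoch_self_ne_zero hq0 hq1 j
  rw [show k + 1 + j = k + j + 1 by ring, qPoch_succ q q k] at h1
  rw [show k + (j + 1) = k + j + 1 by ring, qPoch_succ q q j] at h2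
  rw [show k + j + 1 - k = j + 1 by omega]
  apply mul_right_cancel₀ (mul_ne_zero hk hj)
  rw [pow_succ', pow_succ']
  linear_combination h1 - h2

/-- Summation against Gaussian binomials, by the second Pascal rule. -/
theorem sum_qBinom_succ' {q : ℝ} (hq0 : 0 < q) (hq1 : q < 1) (n : ℕ) (f : ℕ → ℝ) :
    ∑ x ∈ range (n + 2), qBinom q (n + 1) x * f x =
      ∑ x ∈ range (n + 1), qBinom q n x * (f x + q ^ (n - x) * f (x + 1)) := by
  have h : ∑ x ∈ range (n + 1), qBinom q n x * f x =
      ∑ x ∈ range (n + 1), qBinom q n (x + 1) * f (x + 1) + f 0 := by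
    have := sum_range_succ' (fun x => qBinom q n x * f x) (n + 1)
    rw [sum_range_succ, qBinom_eq_zero_of_lt q (Nat.lt_succ_self n)] at this
    simpa [qBinom_zero_right] using this
  simp only [mul_add, sum_add_distrib]
  rw [h, sum_range_succ', qBinom_zero_right, one_mul, add_right_comm, ← sum_add_distrib]
  congr 1
  refine sum_congr rfl fun x hx => ?_
  rw [qBinom_succ_succ]
  linear_combination -f (x + 1) * qBinom_succ_right hq0 hq1 (mem_range_succ_iff.1 hx)

/-! ### The two `q`-Vandermonde sums -/

/-- The `q`-Vandermonde convolution. -/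
theorem sum_qBinom_mul_qPoch (q A B : ℝ) (n : ℕ) :
    ∑ x ∈ range (n + 1), qBinom q n x * (qPoch A q x * qPoch B q (n - x) * A ^ (n - x)) =
      qPoch (A * B) q n := by
  induction n with
  | zero => simp [qPoch_zero, qBinom_zero_right]
  | succ n ih =>
    rw [sum_qBinom_succ, qPoch_succ, ← ih, sum_mul]
    refine sum_congr rfl fun x hx => ?_
    obtain ⟨y, rfl⟩ := Nat.exists_eq_add_of_le (mem_range_succ_iff.1 hx)
    rw [show x + y + 1 - x = y + 1 by omega, show x + y + 1 - (x + 1) = y by omega,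
      show x + y - x = y by omega, qPoch_succ, qPoch_succ]
    ring

/-- The alternating `q`-Vandermonde sum, cleared of denominators. -/
theorem sum_qBinom_alternating {q : ℝ} (hq0 : 0 < q) (hq1 : q < 1) (A D : ℝ) (n : ℕ) :
    ∑ j ∈ range (n + 1), qBinom q n j *
        ((-1) ^ j * q ^ (n - j).choose 2 * qPoch A q j * qPoch (D * q ^ j) q (n - j)) =
      q ^ n.choose 2 * ∏ i ∈ range n, (A - D * q ^ i) := by
  induction n generalizing D with
  | zero => simp [qPoch_zero, qBinom_zero_right]
  | succ n ih =>
    -- Neighbouring terms merge: `(1 - D q^x) - (1 - A q^x) = q^x (A - D)`, leaving `q^n (A - D)`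
    -- times the sum for `D q`.
    have h := ih (D * q)
    rw [sum_qBinom_succ' hq0 hq1, prod_range_succ',
      show (n + 1).choose 2 = n + n.choose 2 by simp [Nat.choose_succ_succ' n 1]]
    have e : ∏ i ∈ range n, (A - D * q ^ (i + 1)) = ∏ i ∈ range n, (A - D * q * q ^ i) :=
      prod_congr rfl fun i _ => by ring
    rw [e, pow_add, pow_zero, mul_one,
      show ∀ u v w z : ℝ, u * v * (w * z) = u * z * (v * w) by intros; ring, ← h, mul_sum]
    refine sum_congr rfl fun x hx => ?_
    obtain ⟨y, rfl⟩ := Nat.exists_eq_add_of_le (mem_range_succ_iff.1 hx)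
    rw [show x + y + 1 - x = y + 1 by omega, show x + y + 1 - (x + 1) = y by omega,
      show x + y - x = y by omega, qPoch_succ A, qPoch_succ' (D * q ^ x),
      show (y + 1).choose 2 = y + y.choose 2 by simp [Nat.choose_succ_succ' y 1],
      show D * q * q ^ x = D * q ^ x * q by ring, show D * q ^ (x + 1) = D * q ^ x * q by ring]
    ring

/-! ### Reversed factorials -/

/-- Reversal of a shifted factorial. -/
theorem qPoch_inv_mul_pow {q B : ℝ} (hq : q ≠ 0) (hB : B ≠ 0) (i j : ℕ) :
    qPoch (B * q ^ (i + j))⁻¹ q j * (B ^ j * q ^ (j * (i + j))) * qPoch (B * q) q i =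
      (-1) ^ j * q ^ j.choose 2 * qPoch (B * q) q (i + j) := by
  induction j with
  | zero => simp [qPoch_zero]
  | succ j ih =>
    have e : (B * q ^ (i + (j + 1)))⁻¹ * q = (B * q ^ (i + j))⁻¹ := by
      field_simp
      ring
    have e2 : (1 - (B * q ^ (i + j + 1))⁻¹) * (B * q ^ (i + j + 1)) = B * q ^ (i + j + 1) - 1 := by
      field_simp
    rw [qPoch_succ', e, show (j + 1) * (i + (j + 1)) = j * (i + j) + j + (i + j + 1) by ring,
      pow_add, pow_add, show (j + 1).choose 2 = j + j.choose 2 by simp [Nat.choose_succ_succ' j 1],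
      show i + (j + 1) = (i + j) + 1 by ring, qPoch_succ]
    linear_combination (B * q ^ (i + j + 1) - 1) * q ^ j * ih + qPoch (B * q ^ (i + j))⁻¹ q j *
      (B ^ j * q ^ (j * (i + j)) * q ^ j) * qPoch (B * q) q i * e2

theorem qPoch_inv_pow {q : ℝ} (hq : q ≠ 0) (i j : ℕ) :
    qPoch (q ^ (i + j))⁻¹ q j * q ^ (j * (i + j)) * qPoch q q i =
      (-1) ^ j * q ^ j.choose 2 * qPoch q q (i + j) := by
  simpa using qPoch_inv_mul_pow hq one_ne_zero i j

theorem choose_two_add (i j : ℕ) :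
    (i + j).choose 2 + j + j.choose 2 = i.choose 2 + j * (i + j) := by
  induction j with
  | zero => simp
  | succ j ih =>
    have h1 : (i + (j + 1)).choose 2 = i + j + (i + j).choose 2 := by
      simp [← add_assoc, Nat.choose_succ_succ' (i + j) 1]
    have h2 : (j + 1).choose 2 = j + j.choose 2 := by simp [Nat.choose_succ_succ' j 1]
    linarith

/-- Coefficients of the terminating series in terms of Gaussian binomials. -/
theorem qPoch_inv_pow_div {q : ℝ} (hq0 : 0 < q) (hq1 : q < 1) {n j : ℕ} (hj : j ≤ n) :
    q ^ n.choose 2 * (qPoch (q ^ n)⁻¹ q j * (q ^ j / qPoch q q j)) =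
      qBinom q n j * ((-1) ^ j * q ^ (n - j).choose 2) := by
  obtain ⟨i, rfl⟩ := Nat.exists_eq_add_of_le' hj
  have hi := qPoch_self_ne_zero hq0 hq1 i
  have hj := qPoch_self_ne_zero hq0 hq1 j
  have h := qPoch_inv_pow hq0.ne' i j
  have hb := qBinom_add_mul q j i
  have hc : q ^ (i + j).choose 2 * q ^ j * q ^ j.choose 2 = q ^ i.choose 2 * q ^ (j * (i + j)) := by
    rw [← pow_add, ← pow_add, ← pow_add, choose_two_add]
  rw [Nat.add_sub_cancel]
  rw [add_comm j i] at hb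
  rw [← hb] at h
  have hp : q ^ (j * (i + j)) ≠ 0 := pow_ne_zero _ hq0.ne'
  rw [← mul_div_assoc, ← mul_div_assoc, div_eq_iff hj]
  apply mul_right_cancel₀ (mul_ne_zero hp hi)
  linear_combination q ^ (i + j).choose 2 * q ^ j * h +
    (-1) ^ j * qBinom q (i + j) j * qPoch q q j * qPoch q q i * hc

/-- The `q`-analogue of `C(N,x) C(x,j) = C(N,j) C(N-j,x-j)`, with `N = j + M` and `x = j + y`. -/
theorem qBinom_mul_qPoch_inv_pow {q : ℝ} (hq0 : 0 < q) (hq1 : q < 1) (j : ℕ) {M y : ℕ}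
    (hy : y ≤ M) :
    qBinom q (j + M) (j + y) * (qPoch (q ^ (j + y))⁻¹ q j * q ^ (j * (j + y))) =
      qPoch (q ^ (j + M))⁻¹ q j * q ^ (j * (j + M)) * qBinom q M y := by
  obtain ⟨z, rfl⟩ := Nat.exists_eq_add_of_le hy
  have hyy := qPoch_self_ne_zero hq0 hq1 y
  have hz := qPoch_self_ne_zero hq0 hq1 z
  have h1 := qPoch_inv_pow hq0.ne' y j
  have h2 := qPoch_inv_pow hq0.ne' (y + z) j
  have hb := qBinom_add_mul q (j + y) z
  have hb2 := qBinom_add_mul q y z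
  rw [add_comm _ j] at h1 h2
  rw [add_assoc] at hb
  rw [← hb2] at h2
  apply mul_right_cancel₀ (mul_ne_zero hyy hz)
  linear_combination qBinom q (j + (y + z)) (j + y) * qPoch q q z * h1 - h2 +
    (-1) ^ j * q ^ j.choose 2 * hb

/-! ### The cleared weight and its moments -/

/-- The `q`-Hahn weight up to a constant factor, cleared of denominators. -/
def polyWeight (q a b : ℝ) (N x : ℕ) : ℝ :=
  qBinom q N x * (qPoch (a * q) q x * qPoch (b * q) q (N - x) * (a * q) ^ (N - x))

theorem qPoch_inv_pow_of_lt {q : ℝ} (hq : q ≠ 0) {x j : ℕ} (h : x < j) :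
    qPoch (q ^ x)⁻¹ q j = 0 :=
  prod_eq_zero (mem_range.2 h) (by rw [inv_mul_cancel₀ (pow_ne_zero _ hq), sub_self])

/-- The terms `x < j` vanish; the rest form a `q`-Vandermonde convolution with `a` replaced by `a
q^j`. -/
theorem sum_polyWeight_mul_qPoch {q : ℝ} (hq0 : 0 < q) (hq1 : q < 1) (a b : ℝ) {N j : ℕ}
    (hj : j ≤ N) :
    ∑ x ∈ range (N + 1), polyWeight q a b N x * qPoch (q ^ x)⁻¹ q j =
      qPoch (q ^ N)⁻¹ q j * qPoch (a * q) q j * qPoch (a * b * q ^ (2 + j)) q (N - j) := by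
  obtain ⟨M, rfl⟩ := Nat.exists_eq_add_of_le hj
  have h0 : ∑ x ∈ range j, polyWeight q a b (j + M) x * qPoch (q ^ x)⁻¹ q j = 0 :=
    sum_eq_zero fun x hx => by
      rw [qPoch_inv_pow_of_lt hq0.ne' (mem_range.1 hx), mul_zero]
  rw [add_assoc, Finset.sum_range_add, h0, zero_add, Nat.add_sub_cancel_left,
    show a * b * q ^ (2 + j) = (a * q ^ j * q) * (b * q) by ring,
    ← sum_qBinom_mul_qPoch q (a * q ^ j * q), mul_sum]
  refine sum_congr rfl fun y hy => ?_
  have hy' := mem_range_succ_iff.1 hy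
  have h := qBinom_mul_qPoch_inv_pow hq0 hq1 j hy'
  obtain ⟨z, rfl⟩ := Nat.exists_eq_add_of_le hy'
  rw [polyWeight, qPoch_add, show j + (y + z) - (j + y) = z by omega,
    show y + z - y = z by omega, show a * q ^ j * q = a * q * q ^ j by ring, mul_pow _ (q ^ j)]
  rw [show j * (j + (y + z)) = j * (j + y) + j * z by ring,
    pow_add q (j * (j + y)), pow_mul q j z] at h
  have hp : q ^ (j * (j + y)) ≠ 0 := pow_ne_zero _ hq0.ne'
  apply mul_right_cancel₀ hp
  linear_combination qPoch (a * q) q j * qPoch (a * q * q ^ j) q y * qPoch (b * q) q z *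
    (a * q) ^ z * h

theorem qPochX_succ (q : ℝ) (m : ℕ) : qPochX q (m + 1) = qPochX q m * (1 - X * C (q ^ m)) := by
  simp [qPochX, prod_range_succ]

theorem eval_qPochX (q y : ℝ) (m : ℕ) : (qPochX q m).eval y = qPoch y q m := by
  simp [qPochX, qPoch, eval_prod]

/-! ### Counting zeros by sign changes -/

/-- A real polynomial keeps a constant sign on `[a, b]` after multiplication by one linear factor
for each of suitably chosen distinct roots in `(a, b)`. -/
theorem exists_mul_prod_constant_sign {a b : ℝ} (hab : a < b) {Q : ℝ[X]} (hQ : Q ≠ 0) :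
    ∃ S : Finset ℝ, (∀ y ∈ S, y ∈ Set.Ioo a b ∧ Q.IsRoot y) ∧
      ((∀ x ∈ Set.Icc a b, 0 ≤ (Q * ∏ y ∈ S, (X - C y)).eval x) ∨
        (∀ x ∈ Set.Icc a b, (Q * ∏ y ∈ S, (X - C y)).eval x ≤ 0)) := by
  induction hd : Q.natDegree using Nat.strong_induction_on generalizing Q with
  | _ d ih =>
    by_cases hr : ∃ r ∈ Set.Ioo a b, Q.IsRoot r
    · obtain ⟨r, hrI, hr⟩ := hr
      obtain ⟨P, rfl⟩ := dvd_iff_isRoot.2 hr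
      have hP : P ≠ 0 := right_ne_zero_of_mul hQ
      have hdeg : P.natDegree < d := by
        rw [← hd, natDegree_mul (X_sub_C_ne_zero r) hP, natDegree_X_sub_C]
        omega
      obtain ⟨S, hS, hsign⟩ := ih _ hdeg hP rfl
      -- Adding the root `r` toggles its membership in `S`, which ends up recording the roots of odd
      -- multiplicity.
      by_cases hrS : r ∈ S
      · refine ⟨S.erase r, fun y hy => ?_, ?_⟩
        · obtain ⟨hI, hy⟩ := hS y (mem_of_mem_erase hy)
          exact ⟨hI, root_mul_left_of_isRoot _ hy⟩
        · have e : (X - C r) * P * ∏ y ∈ S.erase r, (X - C y) = P * ∏ y ∈ S, (X - C y) := by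
            rw [← mul_prod_erase S _ hrS]
            ring
          rwa [e]
      · refine ⟨insert r S, fun y hy => ?_, ?_⟩
        · obtain rfl | hy := mem_insert.1 hy
          · exact ⟨hrI, hr⟩
          · obtain ⟨hI, hy⟩ := hS y hy
            exact ⟨hI, root_mul_left_of_isRoot _ hy⟩
        · have e : ∀ x, ((X - C r) * P * ∏ y ∈ insert r S, (X - C y)).eval x =
              (x - r) ^ 2 * (P * ∏ y ∈ S, (X - C y)).eval x := by
            intro x
            rw [prod_insert hrS]
            simp only [eval_mul, eval_sub, eval_X, eval_C]
            ring
          simp only [e]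
          exact hsign.imp (fun h x hx => mul_nonneg (sq_nonneg _) (h x hx))
            fun h x hx => mul_nonpos_of_nonneg_of_nonpos (sq_nonneg _) (h x hx)
    · push Not at hr
      -- Without interior roots the sign is constant on the open interval; the closure carries it to
      -- the end points, which may be mass points.
      refine ⟨∅, by simp, ?_⟩
      simp only [prod_empty, mul_one]
      have hcl : closure (Set.Ioo a b) = Set.Icc a b := closure_Ioo hab.ne
      have key : (∀ x ∈ Set.Ioo a b, 0 ≤ Q.eval x) ∨ (∀ x ∈ Set.Ioo a b, Q.eval x ≤ 0) := by
        by_contra! hc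
        obtain ⟨⟨x, hx, hx0⟩, y, hy, hy0⟩ := hc
        obtain ⟨z, hz, hz0⟩ := isPreconnected_Ioo.intermediate_value hx hy
          Q.continuous.continuousOn ⟨hx0.le, hy0.le⟩
        exact hr z hz hz0
      rw [← hcl]
      refine key.imp (fun h x hx => ?_) fun h x hx => ?_
      · exact closure_minimal h (isClosed_le continuous_const Q.continuous) hx
      · exact closure_minimal h (isClosed_le Q.continuous continuous_const) hx

theorem IsDiscreteQuasiOrthogonal.sum_mul_eq_zero {Q : ℝ[X]} {n k M : ℕ} {x w : ℕ → ℝ} {a b : ℝ}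
    (h : IsDiscreteQuasiOrthogonal Q n k M x w a b) {P : ℝ[X]} (hP : P.natDegree < n - k) :
    ∑ i ∈ range M, (Q * P).eval (x i) * w i = 0 := by
  have e : ∀ i, (Q * P).eval (x i) * w i =
      ∑ s ∈ range (n - k), P.coeff s * (x i ^ s * Q.eval (x i) * w i) := by
    intro i
    rw [eval_mul, eval_eq_sum_range' hP, mul_sum, sum_mul]
    exact sum_congr rfl fun s _ => by ring
  simp only [e]
  rw [sum_comm]
  refine Finset.sum_eq_zero fun s hs => ?_
  rw [← mul_sum, h.sum_eq_zero s (mem_range.1 hs), mul_zero]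

/-- A discrete quasi-orthogonal polynomial of degree `n` and order `k` has at least `n - k`
distinct zeros in the open interval. -/
theorem IsDiscreteQuasiOrthogonal.le_ncard {Q : ℝ[X]} {n k M : ℕ} {x w : ℕ → ℝ} {a b : ℝ}
    (h : IsDiscreteQuasiOrthogonal Q n k M x w a b) (hab : a < b) (hM : n < M) :
    n - k ≤ {y | y ∈ Set.Ioo a b ∧ Q.IsRoot y}.ncard := by
  have hQ : Q ≠ 0 := by
    rintro rfl
    simpa using h.degree_eq
  obtain ⟨S, hS, hsign⟩ := exists_mul_prod_constant_sign hab hQ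
  have hfin : {y | y ∈ Set.Ioo a b ∧ Q.IsRoot y}.Finite :=
    (finite_setOfPred_isRoot hQ).subset fun y hy => hy.2
  have hcard : S.card ≤ {y | y ∈ Set.Ioo a b ∧ Q.IsRoot y}.ncard := by
    rw [← Set.ncard_coe_finset]
    exact Set.ncard_le_ncard (fun y hy => hS y hy) hfin
  by_contra! hlt
  set P : ℝ[X] := ∏ y ∈ S, (X - C y) with hPdef
  have hPdeg : P.natDegree < n - k := by
    rw [hPdef, natDegree_finsetProd_X_sub_C_eq_card]
    omega
  have hsum := h.sum_mul_eq_zero hPdeg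
  have hzero : ∀ i ∈ range M, (Q * P).eval (x i) * w i = 0 := by
    rcases hsign with hs | hs
    · exact (sum_eq_zero_iff_of_nonneg fun i hi => mul_nonneg
        (hs _ (h.points_mem i (mem_range.1 hi))) (h.weight_pos i (mem_range.1 hi)).le).1 hsum
    · exact (sum_eq_zero_iff_of_nonpos fun i hi => mul_nonpos_of_nonpos_of_nonneg
        (hs _ (h.points_mem i (mem_range.1 hi))) (h.weight_pos i (mem_range.1 hi)).le).1 hsum
  -- Where the extra factor vanishes, the mass point lies in `S` and is a root of `Q` anyway.
  have hroot : ∀ i < M, Q.eval (x i) = 0 := by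
    intro i hi
    have h0 := (mul_eq_zero.1 (hzero i (mem_range.2 hi))).resolve_right (h.weight_pos i hi).ne'
    rw [eval_mul] at h0
    refine (mul_eq_zero.1 h0).elim id fun hP0 => ?_
    rw [hPdef, eval_prod, prod_eq_zero_iff] at hP0
    obtain ⟨y, hy, hxy⟩ := hP0
    rw [eval_sub, eval_X, eval_C, sub_eq_zero] at hxy
    exact hxy ▸ (hS y hy).2
  refine hQ (eq_zero_of_natDegree_lt_card_of_eval_eq_zero' Q ((range M).image x) ?_ ?_)
  · simpa using hroot
  · rw [card_image_of_injOn (by simpa [Set.InjOn] using h.points_inj), card_range,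
      natDegree_eq_of_degree_eq_some h.degree_eq]
    exact hM

/-! ### Test polynomials and parameter shifts -/

theorem natDegree_qPochX {q : ℝ} (hq : q ≠ 0) (m : ℕ) : (qPochX q m).natDegree = m := by
  induction m with
  | zero => simp [qPochX]
  | succ m ih =>
    have h1 : (1 - X * C (q ^ m) : ℝ[X]).natDegree = 1 := by
      rw [show (1 - X * C (q ^ m) : ℝ[X]) = C (-(q ^ m)) * X + C 1 by simp; ring]
      exact natDegree_linear (neg_ne_zero.2 (pow_ne_zero m hq))
    have h2 : qPochX q m ≠ 0 := by
      intro h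
      have := eval_qPochX q 0 m
      simp [h, qPoch] at this
    rw [qPochX_succ, natDegree_mul h2 (by intro h; rw [h] at h1; simp at h1), ih, h1]

theorem degree_qPochX {q : ℝ} (hq : q ≠ 0) (m : ℕ) : (qPochX q m).degree = m := by
  rw [degree_eq_natDegree, natDegree_qPochX hq]
  intro h
  have := eval_qPochX q 0 m
  simp [h, qPoch] at this

theorem degree_qPochX_comp {q c : ℝ} (hq : q ≠ 0) (hc : c ≠ 0) (m : ℕ) :
    ((qPochX q m).comp (C c * X)).degree = m := by
  rw [degree_eq_natDegree, natDegree_comp, natDegree_qPochX hq, natDegree_C_mul_X c hc, mul_one]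
  intro h
  have : ((qPochX q m).comp (C c * X)).eval 0 = 1 := by
    rw [eval_comp, eval_qPochX]
    simp [qPoch]
  simp [h] at this

theorem eval_qPochX_comp (q c y : ℝ) (m : ℕ) :
    ((qPochX q m).comp (C c * X)).eval y = qPoch (c * y) q m := by
  simp [eval_comp, eval_qPochX]

/-- Splits `(bq; q)_(N-x+s)` in two ways. At `y = q^(-x)` the extra factor is `(b q^(N+1) y; q)_s`,
a polynomial in `y`. -/
theorem polyWeight_mul_qPoch (q a b : ℝ) (N x s : ℕ) :
    polyWeight q a b N x * qPoch (b * q * q ^ (N - x)) q s =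
      qPoch (b * q) q s * polyWeight q a (b * q ^ s) N x := by
  have h1 := qPoch_add (b * q) q (N - x) s
  have h2 := qPoch_add (b * q) q s (N - x)
  rw [add_comm, h1] at h2
  rw [polyWeight, polyWeight, show b * q ^ s * q = b * q * q ^ s by ring]
  linear_combination qBinom q N x * qPoch (a * q) q x * (a * q) ^ (N - x) * h2

/-- Splits `(aq; q)_(x+k)` in two ways. The `q^(xk)` from passing to the variable `q^(-x)` and the
`q^((N-x)k)` from the power of `a` combine to a constant. -/
theorem polyWeight_mul_prod {q : ℝ} (hq : q ≠ 0) (a b : ℝ) {N x : ℕ} (hx : x ≤ N) (k : ℕ) :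
    polyWeight q a b N x * (q ^ (N * k) * ∏ i ∈ range k, ((q ^ x)⁻¹ - a * q * q ^ i)) =
      qPoch (a * q) q k * polyWeight q (a * q ^ k) b N x := by
  have h1 := qPoch_add (a * q) q x k
  have h2 := qPoch_add (a * q) q k x
  rw [add_comm, h1] at h2
  have h3 : qPoch (a * q * q ^ x) q k = q ^ (x * k) * ∏ i ∈ range k, ((q ^ x)⁻¹ - a * q * q ^ i) := by
    have e : (q ^ x) ^ k = ∏ _i ∈ range k, q ^ x := by simp
    rw [qPoch, pow_mul, e, ← prod_mul_distrib]
    refine prod_congr rfl fun i _ => ?_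
    rw [mul_sub, mul_inv_cancel₀ (pow_ne_zero x hq)]
    ring
  obtain ⟨y, rfl⟩ := Nat.exists_eq_add_of_le hx
  rw [polyWeight, polyWeight, show a * q ^ k * q = a * q * q ^ k by ring,
    Nat.add_sub_cancel_left, mul_pow (a * q), add_mul, pow_add, ← pow_mul, mul_comm k y]
  rw [h3] at h2
  linear_combination qBinom q (x + y) x * qPoch (b * q) q y * (a * q) ^ y * q ^ (y * k) * h2

/-! ### The moment functional and orthogonality -/

/-- The (not necessarily positive) `q`-Hahn moment functional. -/
noncomputable def hahnFunctional (q a b : ℝ) (N : ℕ) : ℝ[X] →ₗ[ℝ] ℝ :=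
  ∑ x ∈ range (N + 1), polyWeight q a b N x • leval (q ^ x)⁻¹

theorem hahnFunctional_apply (q a b : ℝ) (N : ℕ) (f : ℝ[X]) :
    hahnFunctional q a b N f = ∑ x ∈ range (N + 1), polyWeight q a b N x * f.eval (q ^ x)⁻¹ := by
  simp [hahnFunctional, leval]

theorem qPoch_inv_pow_ne_zero {q : ℝ} (hq0 : 0 < q) (hq1 : q < 1) {N j : ℕ} (hj : j ≤ N) :
    qPoch (q ^ N)⁻¹ q j ≠ 0 := by
  refine qPoch_ne_zero fun i hi h => ?_
  rw [inv_mul_eq_one₀ (pow_ne_zero _ hq0.ne')] at h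
  have := pow_right_injective₀ hq0 hq1.ne h
  omega

/-- The moments cancel the denominators of the series, leaving the alternating sum with `A = a b
q^(n+1)` and `D = a b q^(s+2)`. -/
theorem hahnFunctional_qHahn {q : ℝ} (hq0 : 0 < q) (hq1 : q < 1) {a b b' : ℝ} {N n s : ℕ}
    (hn : n ≤ N) (ha : ∀ j, qPoch (a * q) q j ≠ 0) (hb : b' = b * q ^ s) :
    hahnFunctional q a b' N (qHahn q a b N n) =
      qPoch (a * q) q n * qPoch (q ^ N)⁻¹ q n / qPoch (a * b * q ^ (n + 1)) q n *
        (qPoch (a * b * q ^ (s + 2 + n)) q (N - n) *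
          ∏ i ∈ range n, (a * b * q ^ (n + 1) - a * b * q ^ (s + 2) * q ^ i)) := by
  have hmom : ∀ j ≤ N, hahnFunctional q a b' N (qPochX q j) =
      qPoch (q ^ N)⁻¹ q j * qPoch (a * q) q j * qPoch (a * b' * q ^ (2 + j)) q (N - j) := by
    intro j hj
    rw [hahnFunctional_apply, ← sum_polyWeight_mul_qPoch hq0 hq1 a b' hj]
    simp only [eval_qPochX]
  have hc : q ^ n.choose 2 ≠ 0 := pow_ne_zero _ hq0.ne'
  rw [qHahn, ← smul_eq_C_mul, map_smul, map_sum, smul_eq_mul]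
  simp only [zpow_neg, zpow_natCast]
  congr 1
  apply mul_left_cancel₀ hc
  rw [mul_left_comm, ← sum_qBinom_alternating hq0 hq1, mul_sum, mul_sum]
  refine sum_congr rfl fun j hj => ?_
  have hjn := mem_range_succ_iff.1 hj
  rw [← smul_eq_C_mul, map_smul, smul_eq_mul, hmom j (hjn.trans hn)]
  have h1 := qPoch_inv_pow_div hq0 hq1 hjn
  have h2 := ha j
  have h3 := qPoch_inv_pow_ne_zero hq0 hq1 (hjn.trans hn)
  -- The tail of length `N - n` does not depend on `j` and leaves the sum.
  have h4 : qPoch (a * b' * q ^ (2 + j)) q (N - j) =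
      qPoch (a * b * q ^ (s + 2) * q ^ j) q (n - j) * qPoch (a * b * q ^ (s + 2 + n)) q (N - n) := by
    rw [show N - j = (n - j) + (N - n) by omega, qPoch_add, hb]
    congr 2
    · ring
    · rw [show s + 2 + n = s + 2 + j + (n - j) by omega]
      ring
  rw [h4]
  have h5 : ∀ u v w z : ℝ, u * v / (qPoch (a * q) q j * qPoch (q ^ N)⁻¹ q j) * w *
      (qPoch (q ^ N)⁻¹ q j * qPoch (a * q) q j * z) = u * w * v * z := by
    intro u v w z
    generalize qPoch (q ^ N)⁻¹ q j = t at h3 ⊢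
    field_simp
  rw [h5]
  linear_combination qPoch (a * b * q ^ (n + 1)) q j *
    qPoch (a * b * q ^ (s + 2) * q ^ j) q (n - j) * qPoch (a * b * q ^ (s + 2 + n)) q (N - n) * h1

theorem hahnFunctional_comp_mul {q : ℝ} (hq : q ≠ 0) (a b : ℝ) (N s : ℕ)
    (f : ℝ[X]) :
    hahnFunctional q a b N ((qPochX q s).comp (C (b * q ^ (N + 1)) * X) * f) =
      qPoch (b * q) q s * hahnFunctional q a (b * q ^ s) N f := by
  rw [hahnFunctional_apply, hahnFunctional_apply, mul_sum]
  refine sum_congr rfl fun x hx => ?_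
  have hx' := mem_range_succ_iff.1 hx
  have e : b * q ^ (N + 1) * (q ^ x)⁻¹ = b * q * q ^ (N - x) := by
    rw [pow_sub₀ q hq hx']
    ring
  rw [eval_mul, eval_qPochX_comp, e, ← mul_assoc, polyWeight_mul_qPoch q a b, mul_assoc]

/-- A functional that vanishes on the first `n` members of a graded sequence of polynomials
vanishes on all polynomials of degree less than `n`. -/
theorem map_eq_zero_of_degree_lt {φ : ℝ[X] →ₗ[ℝ] ℝ} {E : ℕ → ℝ[X]} {n : ℕ}
    (hE : ∀ s, (E s).degree = s) (h0 : ∀ s < n, φ (E s) = 0) {f : ℝ[X]}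
    (hf : f.degree < n) : φ f = 0 := by
  induction hd : f.natDegree using Nat.strong_induction_on generalizing f with
  | _ d ih =>
    by_cases hf0 : f = 0
    · rw [hf0, map_zero]
    have hdeg : f.degree = d := by rw [degree_eq_natDegree hf0, hd]
    have hdn : d < n := by
      rw [hdeg] at hf
      exact_mod_cast hf
    have hEd : E d ≠ 0 := fun h => by simpa [h] using hE d
    have hl : (E d).leadingCoeff ≠ 0 := leadingCoeff_ne_zero.2 hEd
    have hc : f.leadingCoeff / (E d).leadingCoeff ≠ 0 :=
      div_ne_zero (leadingCoeff_ne_zero.2 hf0) hl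
    have hlt : (f - C (f.leadingCoeff / (E d).leadingCoeff) * E d).degree < f.degree := by
      refine degree_sub_lt_left ?_ hf0 ?_
      · rw [degree_C_mul hc, hE, hdeg]
      · rw [leadingCoeff_mul, leadingCoeff_C, div_mul_cancel₀ _ hl]
    have hφ : φ (f - C (f.leadingCoeff / (E d).leadingCoeff) * E d) = 0 := by
      by_cases hz : f - C (f.leadingCoeff / (E d).leadingCoeff) * E d = 0
      · rw [hz, map_zero]
      · exact ih _ (hd.subst (motive := fun t => _ < t) (natDegree_lt_natDegree hz hlt)) (hlt.trans hf) rfl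
    rwa [map_sub, ← smul_eq_C_mul, map_smul, h0 d hdn, smul_zero, sub_zero] at hφ

/-- Modulo lower degree, which `φ` kills, `f` is a nonzero multiple of `E n`. This makes the order
exact. -/
theorem map_ne_zero_of_degree_eq {φ : ℝ[X] →ₗ[ℝ] ℝ} {E : ℕ → ℝ[X]} {n : ℕ}
    (hE : ∀ s, (E s).degree = s) (h0 : ∀ s < n, φ (E s) = 0) (hne : φ (E n) ≠ 0) {f : ℝ[X]}
    (hf : f.degree = n) : φ f ≠ 0 := by
  have hf0 : f ≠ 0 := fun h => by simp [h] at hf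
  have hEn : E n ≠ 0 := fun h => by simpa [h] using hE n
  have hl : (E n).leadingCoeff ≠ 0 := leadingCoeff_ne_zero.2 hEn
  have hc : f.leadingCoeff / (E n).leadingCoeff ≠ 0 :=
    div_ne_zero (leadingCoeff_ne_zero.2 hf0) hl
  have hlt : (f - C (f.leadingCoeff / (E n).leadingCoeff) * E n).degree < f.degree := by
    refine degree_sub_lt_left ?_ hf0 ?_
    · rw [degree_C_mul hc, hE, hf]
    · rw [leadingCoeff_mul, leadingCoeff_C, div_mul_cancel₀ _ hl]
  have hφ := map_eq_zero_of_degree_lt hE h0 (hlt.trans_eq hf)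
  rw [map_sub, ← smul_eq_C_mul, map_smul, sub_eq_zero] at hφ
  rw [hφ]
  exact smul_ne_zero hc hne

/-! ### Exact degree, normalization and nondegeneracy -/

theorem degree_qHahn {q : ℝ} (hq0 : 0 < q) (hq1 : q < 1) {a b : ℝ} {N n : ℕ} (hn : n ≤ N)
    (ha : ∀ j, qPoch (a * q) q j ≠ 0) (hab : qPoch (a * b * q ^ (n + 1)) q n ≠ 0) :
    (qHahn q a b N n).degree = n := by
  have hN := qPoch_inv_pow_ne_zero hq0 hq1 hn
  have hnn := qPoch_inv_pow_ne_zero hq0 hq1 (le_refl n)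
  have hqq := qPoch_self_ne_zero hq0 hq1 n
  have hqn : q ^ n ≠ 0 := pow_ne_zero _ hq0.ne'
  have := ha n
  rw [qHahn]
  simp only [zpow_neg, zpow_natCast]
  rw [degree_C_mul (by positivity), sum_range_succ, degree_add_eq_right_of_degree_lt]
  · rw [degree_C_mul (by positivity), degree_qPochX hq0.ne']
  · rw [degree_C_mul (by positivity), degree_qPochX hq0.ne']
    refine (degree_sum_le _ _).trans_lt ((Finset.sup_lt_iff (WithBot.bot_lt_coe n)).2 fun j hj => ?_)
    rw [← smul_eq_C_mul]
    refine (degree_smul_le _ _).trans_lt ?_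
    rw [degree_qPochX hq0.ne']
    exact Nat.cast_lt.2 (mem_range.1 hj)

/-- The weight is a positive multiple of its version cleared of denominators. -/
theorem weight_eq {q α β : ℝ} (hq0 : 0 < q) (hq1 : q < 1) (hα : α ≠ 0) (hβ : β ≠ 0) {N x : ℕ}
    (hx : x ≤ N) (hb : ∀ j, qPoch (β * q) q j ≠ 0) :
    weight q α β N x = (qPoch (β * q) q N * (α * q) ^ N)⁻¹ * polyWeight q α β N x := by
  obtain ⟨i, rfl⟩ := Nat.exists_eq_add_of_le' hx
  have h1 := qPoch_inv_pow hq0.ne' i x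
  have h2 := qPoch_inv_mul_pow hq0.ne' hβ i x
  have h3 := qBinom_add_mul q x i
  have hi := qPoch_self_ne_zero hq0 hq1 i
  have hxx := qPoch_self_ne_zero hq0 hq1 x
  have hbi := hb i
  have hbN := hb (i + x)
  have hq := hq0.ne'
  rw [weight, polyWeight, Nat.add_sub_cancel]
  simp only [zpow_neg, zpow_natCast]
  rw [← mul_inv]
  rw [add_comm x i] at h3
  -- Reversing both factorials produces the same sign and powers of `q`, which cancel in the
  -- quotient.
  have e1 : qPoch (q ^ (i + x))⁻¹ q x =
      (-1) ^ x * q ^ x.choose 2 * (qBinom q (i + x) x * qPoch q q x) / q ^ (x * (i + x)) := by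
    rw [eq_div_iff (pow_ne_zero _ hq)]
    apply mul_right_cancel₀ hi
    linear_combination h1 - (-1) ^ x * q ^ x.choose 2 * h3
  have e2 : qPoch (β * q ^ (i + x))⁻¹ q x =
      (-1) ^ x * q ^ x.choose 2 * qPoch (β * q) q (i + x) / qPoch (β * q) q i /
        (β ^ x * q ^ (x * (i + x))) := by
    rw [eq_div_iff (mul_ne_zero (pow_ne_zero _ hβ) (pow_ne_zero _ hq)), eq_div_iff hbi]
    exact h2
  rw [e1, e2]
  rw [pow_add (α * q), show (α * β * q) ^ x = (α * q) ^ x * β ^ x by ring]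
  have haq : (α * q) ≠ 0 := mul_ne_zero hα hq
  have hp : q ^ (x * (i + x)) ≠ 0 := pow_ne_zero _ hq
  generalize α * q = t at *
  generalize q ^ (x * (i + x)) = t' at *
  field_simp

/-- The value is at most `α q < 1` when `j ≥ k`, and at least `α > 1` when `j < k`. -/
theorem div_pow_mul_ne_one {q α : ℝ} (hq0 : 0 < q) (hq1 : q < 1) (hα0 : 0 < α * q)
    (hα1 : α * q < 1) {k : ℕ} (hk : k = 0 ∨ 1 < α) (j : ℕ) : α / q ^ k * q * q ^ j ≠ 1 := by
  have hq := hq0.ne'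
  obtain hkj | hjk := le_or_gt k j
  · obtain ⟨i, rfl⟩ := Nat.exists_eq_add_of_le hkj
    have e : α / q ^ k * q * q ^ (k + i) = α * q * q ^ i := by
      field_simp
      ring
    rw [e]
    exact (mul_lt_one_of_nonneg_of_lt_one_left hα0.le hα1 (pow_le_one₀ hq0.le hq1.le)).ne
  · obtain ⟨i, rfl⟩ := Nat.exists_eq_add_of_lt hjk
    have e : α / q ^ (j + i + 1) * q * q ^ j = α / q ^ i := by
      field_simp
      ring
    rw [e]
    have h1 : 1 < α := hk.resolve_left (by omega)
    refine ne_of_gt ((one_lt_div (pow_pos hq0 i)).2 ?_)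
    exact (pow_le_one₀ hq0.le hq1.le).trans_lt h1

/-! ### Assembly -/

theorem quasiOrthogonal_qHahn {q α β : ℝ} (hq0 : 0 < q) (hq1 : q < 1)
    (hα0 : 0 < α * q) (hα1 : α * q < 1) (hβ0 : 0 < β * q) (hβ1 : β * q < 1)
    {k m N n : ℕ} (hn : n ≤ N) (hk : k = 0 ∨ 1 < α) (hm : m = 0 ∨ 1 < β) (hkm : k + m < n) :
    QuasiOrthogonal q α β N (qHahn q (α / q ^ k) (β / q ^ m) N n) n (k + m) := by
  have hq := hq0.ne'
  have hα : 0 < α := pos_of_mul_pos_left hα0 hq0.le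
  have hβ : 0 < β := pos_of_mul_pos_left hβ0 hq0.le
  set a := α / q ^ k with ha
  set b := β / q ^ m with hb
  have hak : α = a * q ^ k := by rw [ha]; field_simp
  have hbm : β = b * q ^ m := by rw [hb]; field_simp
  have ha0 : ∀ j, qPoch (a * q) q j ≠ 0 := fun j =>
    qPoch_ne_zero fun i _ => div_pow_mul_ne_one hq0 hq1 hα0 hα1 hk i
  have hb0 : ∀ j, qPoch (b * q) q j ≠ 0 := fun j =>
    qPoch_ne_zero fun i _ => div_pow_mul_ne_one hq0 hq1 hβ0 hβ1 hm i
  -- Since `k + m < n`, the exponent absorbs both shifts and leaves at most `(α q)(β q) < 1`.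
  have hab : ∀ e j, n + 1 ≤ e → qPoch (a * b * q ^ e) q j ≠ 0 := by
    intro e j he
    obtain ⟨i, rfl⟩ := Nat.exists_eq_add_of_le (show k + m + 2 ≤ e by omega)
    have h : a * b * q ^ (k + m + 2 + i) = (α * q) * (β * q) * q ^ i := by
      rw [hak, hbm]
      ring
    rw [h]
    refine (qPoch_pos_of_lt_one hq0 hq1 (by positivity) ?_ j).ne'
    exact mul_lt_one_of_nonneg_of_lt_one_left (by positivity)
      (mul_lt_one_of_nonneg_of_lt_one_left hα0.le hα1 hβ1.le) (pow_le_one₀ hq0.le hq1.le)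
  have hapos : 0 < a := by positivity
  have hbpos : 0 < b := by positivity
  set Q := qHahn q a b N n with hQ
  set E : ℕ → ℝ[X] := fun s => (qPochX q s).comp (C (b * q ^ (N + 1)) * X) with hE
  have hEdeg : ∀ s, (E s).degree = s := degree_qPochX_comp hq (by positivity)
  set φ : ℝ[X] →ₗ[ℝ] ℝ := hahnFunctional q a b N ∘ₗ LinearMap.mulRight ℝ Q with hφ
  have hφE : ∀ s, φ (E s) = qPoch (b * q) q s * _ := fun s => by
    rw [hφ, LinearMap.comp_apply, LinearMap.mulRight_apply, hE]
    exact (hahnFunctional_comp_mul hq a b N s Q).trans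
      (by rw [hahnFunctional_qHahn hq0 hq1 hn ha0 rfl])
  have hφ0 : ∀ s < n, φ (E s) = 0 := by
    intro s hs
    -- The factor `i = n - 1 - s` vanishes, as `s + 2 + i = n + 1`.
    rw [hφE, prod_eq_zero (mem_range.2 (show n - 1 - s < n by omega)), mul_zero, mul_zero, mul_zero]
    obtain ⟨i, rfl⟩ := Nat.exists_eq_add_of_lt hs
    rw [show s + i + 1 - 1 - s = i by omega]
    ring
  have hφn : φ (E n) ≠ 0 := by
    rw [hφE]
    refine mul_ne_zero (hb0 n) (mul_ne_zero (div_ne_zero (mul_ne_zero (ha0 n)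
      (qPoch_inv_pow_ne_zero hq0 hq1 hn)) (hab _ _ le_rfl)) (mul_ne_zero (hab _ _ (by omega))
      (prod_ne_zero_iff.2 fun i _ => ?_)))
    have h : a * b * q ^ (n + 1) - a * b * q ^ (n + 2) * q ^ i =
        a * b * q ^ (n + 1) * (1 - q ^ (i + 1)) := by ring
    rw [h]
    exact mul_ne_zero (by positivity) (sub_ne_zero.2 (pow_lt_one₀ hq0.le hq1 (by omega)).ne')
  set P : ℝ[X] := ∏ i ∈ range k, (X - C (a * q * q ^ i)) with hP
  have hPdeg : P.degree = k := by
    rw [hP, degree_prod, sum_congr rfl fun i _ => degree_X_sub_C _]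
    simp
  have hβN : ∀ j, 0 < qPoch (β * q) q j := qPoch_pos_of_lt_one hq0 hq1 hβ0 hβ1
  have hw : ∀ x ≤ N, weight q α β N x =
      (qPoch (β * q) q N * (α * q) ^ N)⁻¹ * polyWeight q α β N x := fun x hx =>
    weight_eq hq0 hq1 hα.ne' hβ.ne' hx fun j => (hβN j).ne'
  set c := (qPoch (β * q) q N * (α * q) ^ N)⁻¹ *
    (q ^ (N * k) / (qPoch (a * q) q k * qPoch (b * q) q m)) with hc
  have hc0 : c ≠ 0 := by
    have h1 := (hβN N).ne'
    have h2 := ha0 k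
    have h3 := hb0 m
    positivity
  -- Both parameter shifts at once; `c` may be negative, only `c ≠ 0` matters.
  have hwP : ∀ x ≤ N, weight q α β N x =
      c * (polyWeight q a b N x * (P.eval (q ^ x)⁻¹ * (E m).eval (q ^ x)⁻¹)) := by
    intro x hx
    have e : b * q ^ (N + 1) * (q ^ x)⁻¹ = b * q * q ^ (N - x) := by
      rw [pow_sub₀ q hq hx]
      ring
    have h1 := polyWeight_mul_qPoch q α b N x m
    have h2 := polyWeight_mul_prod hq a b hx k
    rw [← hbm] at h1
    rw [← hak] at h2
    have h3 := ha0 k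
    have h4 := hb0 m
    have hPe : P.eval (q ^ x)⁻¹ = ∏ i ∈ range k, ((q ^ x)⁻¹ - a * q * q ^ i) := by
      simp [hP, eval_prod]
    rw [hw x hx, hc, mul_assoc]
    congr 1
    rw [hPe, hE]
    simp only [eval_qPochX_comp]
    rw [e, div_mul_eq_mul_div, eq_div_iff (mul_ne_zero h3 h4)]
    linear_combination -qPoch (a * q) q k * h1 - qPoch (b * q * q ^ (N - x)) q m * h2
  have hsum : ∀ s, ∑ i ∈ range (N + 1), (q ^ (-(i : ℤ))) ^ s * Q.eval (q ^ (-(i : ℤ))) *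
      weight q α β N i = c * φ (X ^ s * (P * E m)) := by
    intro s
    rw [hφ, LinearMap.comp_apply, LinearMap.mulRight_apply, hahnFunctional_apply, mul_sum]
    refine sum_congr rfl fun x hx => ?_
    rw [hwP x (mem_range_succ_iff.1 hx)]
    simp only [zpow_neg, zpow_natCast, eval_mul, eval_pow, eval_X]
    ring
  have hdeg : ∀ s, (X ^ s * (P * E m)).degree = ((s + (k + m) : ℕ) : WithBot ℕ) := by
    intro s
    rw [degree_mul, degree_mul, degree_X_pow, hPdeg, hEdeg]
    push_cast
    rfl
  refine ⟨degree_qHahn hq0 hq1 hn ha0 (hab _ _ le_rfl), hkm.le, fun i hi => ?_, ?_,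
    fun i hi => ?_, fun s hs => ?_, ?_⟩
  · simp only [zpow_neg, zpow_natCast]
    refine ⟨(one_le_inv₀ (pow_pos hq0 i)).2 (pow_le_one₀ hq0.le hq1.le), ?_⟩
    exact inv_anti₀ (pow_pos hq0 N) (pow_le_pow_of_le_one hq0.le hq1.le (by omega))
  · intro i _ j _ hij
    simp only [zpow_neg, zpow_natCast, inv_inj] at hij
    exact pow_right_injective₀ hq0 hq1.ne hij
  · rw [hw i (by omega)]
    have h1 := hβN N
    have h2 := hβN (N - i)
    have h3 := qBinom_pos hq0 hq1 (show i ≤ N by omega)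
    have h4 := qPoch_pos_of_lt_one hq0 hq1 hα0 hα1 i
    rw [polyWeight]
    positivity
  · rw [hsum, map_eq_zero_of_degree_lt hEdeg hφ0, mul_zero]
    rw [hdeg]
    exact_mod_cast (by omega : s + (k + m) < n)
  · rw [hsum]
    refine mul_ne_zero hc0 (map_ne_zero_of_degree_eq hEdeg hφ0 hφn ?_)
    rw [hdeg, Nat.sub_add_cancel hkm.le]

theorem quasiOrthogonal_qHahn_and_le_ncard {q α β : ℝ} (hq0 : 0 < q) (hq1 : q < 1)
    (hα0 : 0 < α * q) (hα1 : α * q < 1) (hβ0 : 0 < β * q) (hβ1 : β * q < 1)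
    {k m N n : ℕ} (hn : n ≤ N) (hk : k = 0 ∨ 1 < α) (hm : m = 0 ∨ 1 < β) (hkm : k + m < n) :
    QuasiOrthogonal q α β N (qHahn q (α / q ^ k) (β / q ^ m) N n) n (k + m) ∧
      n - (k + m) ≤ (zerosIn q N (qHahn q (α / q ^ k) (β / q ^ m) N n)).ncard := by
  have h := quasiOrthogonal_qHahn hq0 hq1 hα0 hα1 hβ0 hβ1 hn hk hm hkm
  refine ⟨h, h.le_ncard ?_ (by omega)⟩
  rw [zpow_neg, zpow_natCast, one_lt_inv₀ (pow_pos hq0 N)]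
  -- `k + m < n ≤ N` forces `N ≠ 0`, so the interval is nondegenerate.
  exact pow_lt_one₀ hq0.le hq1 (by omega)

end QHahn
theorem theorem2p6 (q α β : ℝ) (hq0 : 0 < q) (hq1 : q < 1)
    (hα0 : 0 < α * q) (hα1 : α * q < 1) (hβ0 : 0 < β * q) (hβ1 : β * q < 1)
    (k m N n : ℕ) (hn : n ≤ N) :
    (1 < α → k < n →
      QHahn.QuasiOrthogonal q α β N (QHahn.qHahn q (α / q ^ k) β N n) n k ∧
      n - k ≤ (QHahn.zerosIn q N (QHahn.qHahn q (α / q ^ k) β N n)).ncard) ∧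
    (1 < β → m < n →
      QHahn.QuasiOrthogonal q α β N (QHahn.qHahn q α (β / q ^ m) N n) n m ∧
      n - m ≤ (QHahn.zerosIn q N (QHahn.qHahn q α (β / q ^ m) N n)).ncard) ∧
    (1 < α → 1 < β → k + m < n →
      QHahn.QuasiOrthogonal q α β N (QHahn.qHahn q (α / q ^ k) (β / q ^ m) N n) n (k + m) ∧
      n - (k + m) ≤
        (QHahn.zerosIn q N (QHahn.qHahn q (α / q ^ k) (β / q ^ m) N n)).ncard) := by
  refine ⟨fun hα hk => ?_, fun hβ hm => ?_, fun hα hβ hkm => ?_⟩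
  · simpa using QHahn.quasiOrthogonal_qHahn_and_le_ncard hq0 hq1 hα0 hα1 hβ0 hβ1 hn (m := 0)
      (.inr hα) (.inl rfl) hk
  · simpa using QHahn.quasiOrthogonal_qHahn_and_le_ncard hq0 hq1 hα0 hα1 hβ0 hβ1 hn (k := 0)
      (.inl rfl) (.inr hβ) (by omega)
  · exact QHahn.quasiOrthogonal_qHahn_and_le_ncard hq0 hq1 hα0 hα1 hβ0 hβ1 hn (.inr hα) (.inr hβ)
      hkm
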